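/- Let $n,m,d\ge 1$ be integers and, for $s=0,1,2,\dots$, let $A_s\in\mathbb{R}^{n\times n}$ be non-singular, $B_s\in\mathbb{R}^{n\times m}$, $Q_s\in\mathbb{R}^{n\times n}$ symmetric positive semidefinite with positive semidefinite square root $Q_s^{1/2}$, and $R_s\in\mathbb{R}^{m\times m}$ symmetric positive definite. Fix integers $t,k\ge 0$ and a real $\gamma>0$, and put $\tau=t+dk$. Write $'$ for transpose, and $\lambda_{\min},\lambda_{\max}$ for the smallest and largest eigenvalue of a symmetric matrix. Define the block matrices $$\Lambda=I_{n(d+1)}-\begin{bmatrix}0_{n,nd}&0_{n,n}\\ \mathrm{diag}(A_\tau,\dots,A_{\tau+d-1})&0_{nd,n}\end{bmatrix},\quad \Xi=\begin{bmatrix}0_{n,md}\\ \mathrm{diag}(B_\tau,\dots,B_{\tau+d-1})\end{bmatrix},$$ $$\Gamma=\begin{bmatrix}\mathrm{diag}(Q_\tau^{1/2},\dots,Q_{\tau+d-1}^{1/2})&0_{nd,n}\end{bmatrix},\quad \hat R=\mathrm{diag}(R_\tau,\dots,R_{\tau+d-1}),$$ and the $d$-step lifted matrices $$\hat A=\begin{bmatrix}0&I_n\end{bmatrix}\Lambda^{-1}\begin{bmatrix}I_n\\0\end{bmatrix},\quad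 \hat B=\begin{bmatrix}0&I_n\end{bmatrix}\Lambda^{-1}\Xi,\quad \hat F=\begin{bmatrix}0&I_n\end{bmatrix}\Lambda^{-1}\begin{bmatrix}0\\I_{nd}\end{bmatrix},$$ $$\hat C=\Gamma\Lambda^{-1}\begin{bmatrix}I_n\\0\end{bmatrix},\quad \hat D=\Gamma\Lambda^{-1}\Xi,\quad \hat E=\Gamma\Lambda^{-1}\begin{bmatrix}0\\I_{nd}\end{bmatrix}.$$ Let $\tilde B=\begin{bmatrix}\hat B&\hat F\end{bmatrix}$ and $$\tilde R=\begin{bmatrix}\hat R+\hat D'\hat D&\hat D'\hat E\\ \hat E'\hat D&\hat E'\hat E-\gamma^2I_{nd}\end{bmatrix}.$$ Suppose that $\tilde R$ is non-singular and let $$\tilde Q=\hat C'\hat C-\hat C'\begin{bmatrix}\hat D&\hat E\end{bmatrix}\tilde R^{-1}\begin{bmatrix}\hat D'\\ \hat E'\end{bmatrix}\hat C,\qquad \tilde A=\hat A-\tilde B\tilde R^{-1}\begin{bmatrix}\hat D'\\ \hat E'\end{bmatrix}\hat C.$$ Suppose further that $\tilde B\tilde R^{-1}\tilde B'$ and $\tilde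 Q$ are (symmetric) positive definite. Then $\tilde A$ is non-singular; for every symmetric positive definite $X\in\mathbb{R}^{n\times n}$ the matrix $\tilde R+\tilde B'X\tilde B$ is non-singular and $$\mathcal{R}(X)=\tilde Q+\tilde A'\bigl(X-X\tilde B(\tilde R+\tilde B'X\tilde B)^{-1}\tilde B'X\bigr)\tilde A$$ is symmetric positive definite; the numbers $$\tilde\zeta=\frac{1}{\lambda_{\min}\bigl(\tilde Q+\tilde Q\tilde A^{-1}\tilde B\tilde R^{-1}\tilde B'(\tilde A')^{-1}\tilde Q\bigr)},\qquad \tilde\epsilon=\frac{1}{\lambda_{\max}\bigl(\tilde Q+\tilde A'(\tilde B\tilde R^{-1}\tilde B')^{-1}\tilde A\bigr)}$$ are positive, so that $\tilde\rho=\tilde\zeta/(\tilde\zeta+\tilde\epsilon)<1$; and for all symmetric positive definite $X,P\in\mathbb{R}^{n\times n}$, $$\delta(\mathcal{R}(X),\mathcal{R}(P))\le\tilde\rho\,\delta(X,P),$$ where $\delta(X,P)=\bigl(\sum_{i=1}^n(\log\lambda_i)^2\bigr)^{1/2}$ and $\lambda_1,\dots,\lambda_n$ are the eigenvalues of $XP^{-1}$,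 counted with multiplicity. -/

import Mathlib

/-- Model data `A_t, B_t, Q_t, R_t` (`t = 0, 1, 2, …`) of the time-varying system
`x_{t+1} = A_t x_t + B_t u_t + w_t`, `z_t = (Q_t^{1/2} x_t, R_t^{1/2} u_t)`,
with state and disturbance of dimension `n` and control input of dimension `m`. -/
structure ModelData (n m : ℕ) where
  A : ℕ → Matrix (Fin n) (Fin n) ℝ
  B : ℕ → Matrix (Fin n) (Fin m) ℝ
  Q : ℕ → Matrix (Fin n) (Fin n) ℝ
  R : ℕ → Matrix (Fin m) (Fin m) ℝ

/-- The smallest eigenvalue of a real symmetric matrix. -/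
noncomputable def lamMin {n : ℕ} (Y : Matrix (Fin n) (Fin n) ℝ) : ℝ :=
  sInf (spectrum ℝ Y)

/-- The largest eigenvalue of a real symmetric matrix. -/
noncomputable def lamMax {n : ℕ} (Y : Matrix (Fin n) (Fin n) ℝ) : ℝ :=
  sSup (spectrum ℝ Y)

/-- The Riemannian distance `(∑ (log λ_i)²)^{1/2}` between positive definite matrices `X`, `P`,
where the `λ_i` are the eigenvalues of `X P⁻¹`, counted with multiplicity. -/
noncomputable def riemDist {n : ℕ} (X P : Matrix (Fin n) (Fin n) ℝ) : ℝ :=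
  Real.sqrt (((X * P⁻¹).charpoly.roots.map (fun l => (Real.log l) ^ 2)).sum)

/-! Stacked vectors with `d` (or `d + 1`) blocks of size `n` are indexed by `Fin n × Fin d`
(or `Fin n × Fin (d + 1)`): first the coordinate, then the block. This is the convention of
`Matrix.blockDiagonal`. The next four matrices are the block matrices made of `0` and `I`. -/

/-- The block column `[I_n ; 0_{nd,n}]`. -/
def firstCol (n d : ℕ) : Matrix (Fin n × Fin (d + 1)) (Fin n) ℝ :=
  Matrix.of fun p a => if p.2 = 0 ∧ p.1 = a then 1 else 0

/-- The block row `[0_{n,nd}  I_n]`. -/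
def lastRow (n d : ℕ) : Matrix (Fin n) (Fin n × Fin (d + 1)) ℝ :=
  Matrix.of fun a p => if p.2 = Fin.last d ∧ p.1 = a then 1 else 0

/-- The block column `[0_{n,nd} ; I_{nd}]`. -/
def tailCol (n d : ℕ) : Matrix (Fin n × Fin (d + 1)) (Fin n × Fin d) ℝ :=
  Matrix.of fun p q => if p.2 = q.2.succ ∧ p.1 = q.1 then 1 else 0

/-- The block row `[I_{nd}  0_{nd,n}]`. -/
def initRow (n d : ℕ) : Matrix (Fin n × Fin d) (Fin n × Fin (d + 1)) ℝ :=
  Matrix.of fun q p => if p.2 = q.2.castSucc ∧ p.1 = q.1 then 1 else 0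

namespace ModelData

variable {n m : ℕ} (S : ModelData n m) (d t k : ℕ)

/-- `diag(A_{t+dk}, …, A_{t+d(k+1)-1})`. -/
def diagA : Matrix (Fin n × Fin d) (Fin n × Fin d) ℝ :=
  Matrix.blockDiagonal fun i : Fin d => S.A (t + d * k + i)

/-- `diag(B_{t+dk}, …, B_{t+d(k+1)-1})`. -/
def diagB : Matrix (Fin n × Fin d) (Fin m × Fin d) ℝ :=
  Matrix.blockDiagonal fun i : Fin d => S.B (t + d * k + i)

section
open scoped MatrixOrder

/-- `diag(Q_{t+dk}^{1/2}, …, Q_{t+d(k+1)-1}^{1/2})`, with positive semidefinite square roots. -/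
noncomputable def diagSqrtQ : Matrix (Fin n × Fin d) (Fin n × Fin d) ℝ :=
  Matrix.blockDiagonal fun i : Fin d => CFC.sqrt (S.Q (t + d * k + i))

end

/-- `Λ = I_{n(d+1)} - [0 0 ; diag(A_{t+dk}, …, A_{t+d(k+1)-1}) 0]`. -/
def Lam : Matrix (Fin n × Fin (d + 1)) (Fin n × Fin (d + 1)) ℝ :=
  1 - tailCol n d * S.diagA d t k * initRow n d

/-- `Ξ = [0 ; diag(B_{t+dk}, …, B_{t+d(k+1)-1})]`. -/
def Xi : Matrix (Fin n × Fin (d + 1)) (Fin m × Fin d) ℝ :=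
  tailCol n d * S.diagB d t k

/-- `Γ = [diag(Q_{t+dk}^{1/2}, …, Q_{t+d(k+1)-1}^{1/2})  0]`. -/
noncomputable def Gam : Matrix (Fin n × Fin d) (Fin n × Fin (d + 1)) ℝ :=
  S.diagSqrtQ d t k * initRow n d

/-- The `d`-step lifted matrix `R = diag(R_{t+dk}, …, R_{t+d(k+1)-1})`. -/
def liftR : Matrix (Fin m × Fin d) (Fin m × Fin d) ℝ :=
  Matrix.blockDiagonal fun i : Fin d => S.R (t + d * k + i)

/-- The lifted `A = [0 I] Λ⁻¹ [I ; 0]`. -/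
noncomputable def liftA : Matrix (Fin n) (Fin n) ℝ :=
  lastRow n d * (S.Lam d t k)⁻¹ * firstCol n d

/-- The lifted `B = [0 I] Λ⁻¹ Ξ`. -/
noncomputable def liftB : Matrix (Fin n) (Fin m × Fin d) ℝ :=
  lastRow n d * (S.Lam d t k)⁻¹ * S.Xi d t k

/-- The lifted `F = [0 I] Λ⁻¹ [0 ; I]`. -/
noncomputable def liftF : Matrix (Fin n) (Fin n × Fin d) ℝ :=
  lastRow n d * (S.Lam d t k)⁻¹ * tailCol n d

/-- The lifted `C = Γ Λ⁻¹ [I ; 0]`. -/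
noncomputable def liftC : Matrix (Fin n × Fin d) (Fin n) ℝ :=
  S.Gam d t k * (S.Lam d t k)⁻¹ * firstCol n d

/-- The lifted `D = Γ Λ⁻¹ Ξ`. -/
noncomputable def liftD : Matrix (Fin n × Fin d) (Fin m × Fin d) ℝ :=
  S.Gam d t k * (S.Lam d t k)⁻¹ * S.Xi d t k

/-- The lifted `E = Γ Λ⁻¹ [0 ; I]`. -/
noncomputable def liftE : Matrix (Fin n × Fin d) (Fin n × Fin d) ℝ :=
  S.Gam d t k * (S.Lam d t k)⁻¹ * tailCol n d

/-- `[D  E]`. -/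
noncomputable def liftDE : Matrix (Fin n × Fin d) ((Fin m × Fin d) ⊕ (Fin n × Fin d)) ℝ :=
  Matrix.fromCols (S.liftD d t k) (S.liftE d t k)

/-- `B̃ = [B  F]`. -/
noncomputable def tilB : Matrix (Fin n) ((Fin m × Fin d) ⊕ (Fin n × Fin d)) ℝ :=
  Matrix.fromCols (S.liftB d t k) (S.liftF d t k)

variable (γ : ℝ)

/-- `R̃ = [R + D'D  D'E ; E'D  E'E - γ² I]`. -/
noncomputable def tilR :
    Matrix ((Fin m × Fin d) ⊕ (Fin n × Fin d)) ((Fin m × Fin d) ⊕ (Fin n × Fin d)) ℝ :=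
  Matrix.fromBlocks
    (S.liftR d t k + (S.liftD d t k).transpose * S.liftD d t k)
    ((S.liftD d t k).transpose * S.liftE d t k)
    ((S.liftE d t k).transpose * S.liftD d t k)
    ((S.liftE d t k).transpose * S.liftE d t k - γ ^ 2 • 1)

/-- `Q̃ = C'C - C' [D E] R̃⁻¹ [D E]' C`. -/
noncomputable def tilQ : Matrix (Fin n) (Fin n) ℝ :=
  (S.liftC d t k).transpose * S.liftC d t k
    - (S.liftC d t k).transpose * S.liftDE d t k * (S.tilR d t k γ)⁻¹
        * (S.liftDE d t k).transpose * S.liftC d t k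

/-- `Ã = A - [B F] R̃⁻¹ [D E]' C`. -/
noncomputable def tilA : Matrix (Fin n) (Fin n) ℝ :=
  S.liftA d t k
    - S.tilB d t k * (S.tilR d t k γ)⁻¹ * (S.liftDE d t k).transpose * S.liftC d t k

/-- `B̃ R̃⁻¹ B̃'`. -/
noncomputable def tilBRB : Matrix (Fin n) (Fin n) ℝ :=
  S.tilB d t k * (S.tilR d t k γ)⁻¹ * (S.tilB d t k).transpose

/-- The lifted Riccati operator `X ↦ Q̃ + Ã'(X - X B̃ (R̃ + B̃' X B̃)⁻¹ B̃' X) Ã`. -/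
noncomputable def riccati (X : Matrix (Fin n) (Fin n) ℝ) : Matrix (Fin n) (Fin n) ℝ :=
  S.tilQ d t k γ + (S.tilA d t k γ).transpose *
    (X - X * S.tilB d t k
        * (S.tilR d t k γ + (S.tilB d t k).transpose * X * S.tilB d t k)⁻¹
        * (S.tilB d t k).transpose * X) * S.tilA d t k γ

/-- `ζ̃ = 1 / λ_min(Q̃ + Q̃ Ã⁻¹ B̃ R̃⁻¹ B̃' (Ã')⁻¹ Q̃)`. -/
noncomputable def zeta : ℝ :=
  1 / lamMin (S.tilQ d t k γ
    + S.tilQ d t k γ * (S.tilA d t k γ)⁻¹ * S.tilBRB d t k γ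
        * (S.tilA d t k γ).transpose⁻¹ * S.tilQ d t k γ)

/-- `ε̃ = 1 / λ_max(Q̃ + Ã' (B̃ R̃⁻¹ B̃')⁻¹ Ã)`. -/
noncomputable def epsilon : ℝ :=
  1 / lamMax (S.tilQ d t k γ
    + (S.tilA d t k γ).transpose * (S.tilBRB d t k γ)⁻¹ * S.tilA d t k γ)

/-- The contraction rate `ρ̃ = ζ̃ / (ζ̃ + ε̃)`. -/
noncomputable def rho : ℝ :=
  S.zeta d t k γ / (S.zeta d t k γ + S.epsilon d t k γ)

end ModelData

/-! Write W for `tilBRB` and T for `tilA`. By Woodbury (`sub_mul_inv_mul_eq_inv`, `riccati_eq`) the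
Riccati operator is Y ↦ Q̃ + (Y⁻¹ + V)⁻¹ evaluated at Y = T'XT, with V = T⁻¹W(T')⁻¹. Congruence and
inversion are isometries of `riemDist`, so only the effect of adding a matrix matters. By
`inv_add_inv_inv_add`, the inverse of the value is (H + G'YG)⁻¹ + K with H = Q̃ + Q̃VQ̃, G = Q̃⁻¹H,
K = (Q̃ + V⁻¹)⁻¹. Adding H does not expand. Since (H + G'YG)⁻¹ ≤ ζ̃I and K ≥ ε̃I, adding K contracts
by 1/(1 + ε̃/ζ̃) = ρ̃ (`riemDist_add_le`).

That last lemma compares sorted relative eigenvalues one by one, with a min-max test vector and the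
scalar bound `add_le_rpow_mul_add`.

T is non-singular because a null vector would start a stationary trajectory of the underlying
quadratic game that ends at state zero, and backward recursion shows that such a trajectory
vanishes. -/

open Matrix

/-! ### Action of the block selection matrices on stacked vectors. -/

section BlockVectors

variable {n d : ℕ}

theorem blockDiagonal_mulVec_apply {p q : Type*} [Fintype q]
    (M : Fin d → Matrix p q ℝ) (v : q × Fin d → ℝ) (a : p) (i : Fin d) :
    (blockDiagonal M *ᵥ v) (a, i) = (M i *ᵥ fun b => v (b, i)) a := by
  simp [mulVec, dotProduct, Fintype.sum_prod_type, blockDiagonal_apply, ite_mul]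

theorem firstCol_mulVec_zero (x : Fin n → ℝ) (a : Fin n) :
    (firstCol n d *ᵥ x) (a, 0) = x a := by
  simp [firstCol, mulVec, dotProduct]

theorem firstCol_mulVec_succ (x : Fin n → ℝ) (a : Fin n) (i : Fin d) :
    (firstCol n d *ᵥ x) (a, i.succ) = 0 := by
  simp [firstCol, mulVec, dotProduct]

theorem lastRow_mulVec_apply (ξ : Fin n × Fin (d + 1) → ℝ) (a : Fin n) :
    (lastRow n d *ᵥ ξ) a = ξ (a, Fin.last d) := by
  simp [lastRow, mulVec, dotProduct, Fintype.sum_prod_type, ite_and]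

theorem tailCol_mulVec_zero (v : Fin n × Fin d → ℝ) (a : Fin n) :
    (tailCol n d *ᵥ v) (a, 0) = 0 := by
  simp [tailCol, mulVec, dotProduct, (Fin.succ_ne_zero _).symm]

theorem tailCol_mulVec_succ (v : Fin n × Fin d → ℝ) (a : Fin n) (i : Fin d) :
    (tailCol n d *ᵥ v) (a, i.succ) = v (a, i) := by
  simp [tailCol, mulVec, dotProduct, Fintype.sum_prod_type, ite_and]

theorem tailCol_transpose_mulVec_apply (η : Fin n × Fin (d + 1) → ℝ) (a : Fin n) (i : Fin d) :
    ((tailCol n d)ᵀ *ᵥ η) (a, i) = η (a, i.succ) := by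
  simp [tailCol, mulVec, dotProduct, Fintype.sum_prod_type, ite_and]

theorem initRow_mulVec_apply (ξ : Fin n × Fin (d + 1) → ℝ) (a : Fin n) (i : Fin d) :
    (initRow n d *ᵥ ξ) (a, i) = ξ (a, i.castSucc) := by
  simp [initRow, mulVec, dotProduct, Fintype.sum_prod_type, ite_and]

theorem initRow_transpose_mulVec_castSucc (v : Fin n × Fin d → ℝ) (a : Fin n) (i : Fin d) :
    ((initRow n d)ᵀ *ᵥ v) (a, i.castSucc) = v (a, i) := by
  simp [initRow, mulVec, dotProduct, Fintype.sum_prod_type, ite_and]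

theorem initRow_transpose_mulVec_last (v : Fin n × Fin d → ℝ) (a : Fin n) :
    ((initRow n d)ᵀ *ᵥ v) (a, Fin.last d) = 0 := by
  simp [initRow, mulVec, dotProduct, (Fin.castSucc_ne_last _).symm]

end BlockVectors

/-! ### State and costate recursions; non-singularity of `tilA`. -/

namespace ModelData

variable {n m : ℕ} (S : ModelData n m) (d t k : ℕ)

theorem Lam_mulVec_zero (ξ : Fin n × Fin (d + 1) → ℝ) (a : Fin n) :
    (S.Lam d t k *ᵥ ξ) (a, 0) = ξ (a, 0) := by
  simp [Lam, sub_mulVec, ← mulVec_mulVec, tailCol_mulVec_zero]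

theorem Lam_mulVec_succ (ξ : Fin n × Fin (d + 1) → ℝ) (a : Fin n) (i : Fin d) :
    (S.Lam d t k *ᵥ ξ) (a, i.succ) =
      ξ (a, i.succ) - (S.A (t + d * k + i) *ᵥ fun b => ξ (b, i.castSucc)) a := by
  simp [Lam, sub_mulVec, ← mulVec_mulVec, tailCol_mulVec_succ, diagA, blockDiagonal_mulVec_apply,
    initRow_mulVec_apply]

theorem Lam_transpose_mulVec_castSucc (η : Fin n × Fin (d + 1) → ℝ) (a : Fin n) (i : Fin d) :
    ((S.Lam d t k)ᵀ *ᵥ η) (a, i.castSucc) =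
      η (a, i.castSucc) - ((S.A (t + d * k + i))ᵀ *ᵥ fun b => η (b, i.succ)) a := by
  simp [Lam, sub_mulVec, ← mulVec_mulVec, initRow_transpose_mulVec_castSucc, diagA,
    blockDiagonal_mulVec_apply, tailCol_transpose_mulVec_apply, transpose_mul,
    blockDiagonal_transpose]

theorem Lam_transpose_mulVec_last (η : Fin n × Fin (d + 1) → ℝ) (a : Fin n) :
    ((S.Lam d t k)ᵀ *ᵥ η) (a, Fin.last d) = η (a, Fin.last d) := by
  simp [Lam, sub_mulVec, ← mulVec_mulVec, initRow_transpose_mulVec_last, transpose_mul]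

/-- Λ is block lower triangular with identity diagonal, so forward substitution determines a kernel
vector block by block. -/
theorem isUnit_det_Lam : IsUnit (S.Lam d t k).det := by
  rw [isUnit_iff_ne_zero]
  intro h
  obtain ⟨ξ, hξ, h0⟩ := exists_mulVec_eq_zero_iff.2 h
  apply hξ
  have key : ∀ i : Fin (d + 1), ∀ a, ξ (a, i) = 0 := by
    intro i
    induction i using Fin.induction with
    | zero => intro a; rw [← S.Lam_mulVec_zero d t k ξ a, h0]; rfl
    | succ i ih =>
      intro a
      have h1 := S.Lam_mulVec_succ d t k ξ a i
      have h2 : (fun b => ξ (b, i.castSucc)) = 0 := funext ih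
      rw [h0, h2] at h1
      simpa using h1.symm
  ext ⟨a, i⟩
  exact key i a

/-- The optimality system of the lifted quadratic game, with zero terminal state, has only the
zero solution. -/
theorem eq_zero_of_stationary (hA : ∀ s : ℕ, IsUnit (S.A s).det)
    (hR : ∀ s : ℕ, (S.R s).PosDef) {γ : ℝ} (hγ : γ ≠ 0)
    (x : Fin n → ℝ) (u : Fin m × Fin d → ℝ) (v : Fin n × Fin d → ℝ)
    (ξ η : Fin n × Fin (d + 1) → ℝ)
    (hξ : S.Lam d t k *ᵥ ξ = firstCol n d *ᵥ x + S.Xi d t k *ᵥ u + tailCol n d *ᵥ v)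
    (hη : (S.Lam d t k)ᵀ *ᵥ η = (S.Gam d t k)ᵀ *ᵥ (S.Gam d t k *ᵥ ξ))
    (hu : S.liftR d t k *ᵥ u + (S.Xi d t k)ᵀ *ᵥ η = 0)
    (hv : (tailCol n d)ᵀ *ᵥ η = γ ^ 2 • v)
    (hlast : lastRow n d *ᵥ ξ = 0) : x = 0 := by
  have key : ∀ i : Fin (d + 1), (∀ a, ξ (a, i) = 0) ∧ ∀ a, η (a, i) = 0 := by
    intro i
    induction i using Fin.reverseInduction with
    | last =>
      -- The last block column of Γ is zero, so the terminal costate vanishes.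
      refine ⟨fun a => by rw [← lastRow_mulVec_apply ξ a, hlast]; rfl, fun a => ?_⟩
      rw [← S.Lam_transpose_mulVec_last d t k η a, hη, Gam, transpose_mul, ← mulVec_mulVec,
        initRow_transpose_mulVec_last]
    | cast i ih =>
      obtain ⟨ihξ, ihη⟩ := ih
      have hηz : (fun b => η (b, i.succ)) = 0 := funext ihη
      -- A zero costate at i + 1 forces the disturbance and the control at i to vanish;
      -- invertibility of A then carries the zero state back one step.
      have hvz : ∀ a, v (a, i) = 0 := by
        intro a
        have h := congrFun hv (a, i)
        rw [tailCol_transpose_mulVec_apply, ihη a] at h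
        simpa [hγ] using h.symm
      have huz : (fun b => u (b, i)) = 0 := by
        have h : S.R (t + d * k + i) *ᵥ (fun b => u (b, i)) = 0 := by
          ext a
          have h := congrFun hu (a, i)
          have h2 : (fun b => ((tailCol n d)ᵀ *ᵥ η) (b, i)) = 0 := by
            ext b; rw [tailCol_transpose_mulVec_apply, ihη]; rfl
          simpa [liftR, Xi, transpose_mul, ← mulVec_mulVec, diagB, blockDiagonal_transpose,
            blockDiagonal_mulVec_apply, h2] using h
        have hinj := mulVec_injective_of_isUnit (hR (t + d * k + i)).isUnit
        exact hinj (by simpa using h)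
      have hξz : (fun b => ξ (b, i.castSucc)) = 0 := by
        have h : S.A (t + d * k + i) *ᵥ (fun b => ξ (b, i.castSucc)) = 0 := by
          ext a
          have h := congrFun hξ (a, i.succ)
          rw [Lam_mulVec_succ, ihξ] at h
          simpa [firstCol_mulVec_succ, tailCol_mulVec_succ, Xi, ← mulVec_mulVec, diagB,
            blockDiagonal_mulVec_apply, huz, hvz] using h
        have hinj := mulVec_injective_of_isUnit ((isUnit_iff_isUnit_det _).2 (hA (t + d * k + i)))
        exact hinj (by simpa using h)
      refine ⟨fun a => congrFun hξz a, fun a => ?_⟩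
      have h := congrFun hη (a, i.castSucc)
      have h2 : initRow n d *ᵥ ξ = fun q => ξ (q.1, q.2.castSucc) := by
        ext ⟨b, j⟩; rw [initRow_mulVec_apply]
      have h3 : (fun b => (S.Gam d t k *ᵥ ξ) (b, i)) = 0 := by
        ext b
        simp [Gam, ← mulVec_mulVec, diagSqrtQ, blockDiagonal_mulVec_apply, h2, hξz]
      rw [Lam_transpose_mulVec_castSucc, hηz] at h
      simp only [mulVec_zero, Pi.zero_apply, sub_zero] at h
      rw [h]
      nth_rewrite 1 [Gam]
      rw [transpose_mul, ← mulVec_mulVec, initRow_transpose_mulVec_castSucc, diagSqrtQ,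
        blockDiagonal_transpose, blockDiagonal_mulVec_apply, h3]
      simp
  ext a
  have h := congrFun hξ (a, 0)
  rw [Lam_mulVec_zero, (key 0).1] at h
  simpa [firstCol_mulVec_zero, Xi, ← mulVec_mulVec, tailCol_mulVec_zero] using h.symm

/-- If x is a null vector, the stationary input for initial state x steers the lifted system to 0,
and `eq_zero_of_stationary` gives x = 0. -/
theorem isUnit_det_tilA (hA : ∀ s : ℕ, IsUnit (S.A s).det)
    (hR : ∀ s : ℕ, (S.R s).PosDef) {γ : ℝ} (hγ : γ ≠ 0)
    (hRt : IsUnit (S.tilR d t k γ).det) : IsUnit (S.tilA d t k γ).det := by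
  rw [isUnit_iff_ne_zero]
  intro h
  obtain ⟨x, hx, h0⟩ := exists_mulVec_eq_zero_iff.2 h
  apply hx
  set w := -((S.tilR d t k γ)⁻¹ *ᵥ ((S.liftDE d t k)ᵀ *ᵥ (S.liftC d t k *ᵥ x))) with hw
  have hRw : S.tilR d t k γ *ᵥ w = -((S.liftDE d t k)ᵀ *ᵥ (S.liftC d t k *ᵥ x)) := by
    rw [hw, mulVec_neg, mulVec_mulVec _ _ (_⁻¹), mul_nonsing_inv _ hRt, one_mulVec]
  have hBw : S.liftA d t k *ᵥ x + S.tilB d t k *ᵥ w = 0 := by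
    rw [tilA, sub_mulVec] at h0
    simp only [← mulVec_mulVec] at h0
    rw [hw, mulVec_neg, ← sub_eq_add_neg, h0]
  obtain ⟨u, v, huv⟩ : ∃ u v, w = Sum.elim u v :=
    ⟨w ∘ Sum.inl, w ∘ Sum.inr, (Sum.elim_comp_inl_inr w).symm⟩
  have hL := S.isUnit_det_Lam d t k
  -- ξ is the state trajectory generated by (x, u, v), and η the costate driven backward by the
  -- output Γξ.
  set ξ := (S.Lam d t k)⁻¹ *ᵥ (firstCol n d *ᵥ x + S.Xi d t k *ᵥ u + tailCol n d *ᵥ v) with hξ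
  set η := ((S.Lam d t k)⁻¹)ᵀ *ᵥ ((S.Gam d t k)ᵀ *ᵥ (S.Gam d t k *ᵥ ξ)) with hη
  have hz : S.Gam d t k *ᵥ ξ = S.liftC d t k *ᵥ x + S.liftD d t k *ᵥ u + S.liftE d t k *ᵥ v := by
    simp [hξ, liftC, liftD, liftE, ← mulVec_mulVec, mulVec_add]
  rw [huv] at hRw hBw
  have hRw' : ∀ i, (S.tilR d t k γ *ᵥ Sum.elim u v) i =
    (-((S.liftDE d t k)ᵀ *ᵥ (S.liftC d t k *ᵥ x))) i := fun i => congrFun hRw i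
  rw [tilR, fromBlocks_mulVec, liftDE, transpose_fromCols, fromRows_mulVec] at hRw'
  refine S.eq_zero_of_stationary d t k hA hR hγ x u v ξ η ?_ ?_ ?_ ?_ ?_
  · rw [hξ, mulVec_mulVec, mul_nonsing_inv _ hL, one_mulVec]
  · rw [hη, mulVec_mulVec, ← transpose_mul, nonsing_inv_mul _ hL, transpose_one, one_mulVec]
  · have h1 : (S.Xi d t k)ᵀ *ᵥ η = (S.liftD d t k)ᵀ *ᵥ (S.Gam d t k *ᵥ ξ) := by
      simp [hη, liftD, transpose_mul, mulVec_mulVec, Matrix.mul_assoc]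
    rw [h1, hz]
    ext i
    have h2 := hRw' (Sum.inl i)
    simp [add_mulVec, ← mulVec_mulVec, mulVec_add] at h2 ⊢
    linarith
  · have h1 : (tailCol n d)ᵀ *ᵥ η = (S.liftE d t k)ᵀ *ᵥ (S.Gam d t k *ᵥ ξ) := by
      simp [hη, liftE, transpose_mul, mulVec_mulVec, Matrix.mul_assoc]
    rw [h1, hz]
    ext i
    have h2 := hRw' (Sum.inr i)
    simp [add_mulVec, sub_mulVec, ← mulVec_mulVec, mulVec_add, smul_mulVec] at h2 ⊢
    linarith
  · rw [← hBw, tilB, fromCols_mulVec]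
    simp [hξ, liftA, liftB, liftF, ← mulVec_mulVec, mulVec_add, add_assoc]

end ModelData

/-! ### Quadratic forms and bounds on inverses. -/

section QuadraticForms

variable {ι κ : Type*} [Fintype ι] [Fintype κ]

theorem dotProduct_transpose_mul_mul_mulVec (M : Matrix ι ι ℝ) (T : Matrix ι κ ℝ) (x : κ → ℝ) :
    x ⬝ᵥ (Tᵀ * M * T) *ᵥ x = (T *ᵥ x) ⬝ᵥ M *ᵥ (T *ᵥ x) := by
  rw [← mulVec_mulVec, ← mulVec_mulVec, dotProduct_mulVec, vecMul_transpose]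

theorem Matrix.IsHermitian.dotProduct_mulVec_comm {M : Matrix ι ι ℝ} (hM : M.IsHermitian)
    (x y : ι → ℝ) : x ⬝ᵥ M *ᵥ y = y ⬝ᵥ M *ᵥ x := by
  rw [dotProduct_mulVec, ← mulVec_transpose, ← conjTranspose_eq_transpose_of_trivial, hM.eq,
    dotProduct_comm]

theorem Matrix.PosDef.quad_pos {M : Matrix ι ι ℝ} (hM : M.PosDef) {x : ι → ℝ} (hx : x ≠ 0) :
    0 < x ⬝ᵥ M *ᵥ x := by
  simpa using hM.dotProduct_mulVec_pos hx

theorem Matrix.PosSemidef.quad_nonneg {M : Matrix ι ι ℝ} (hM : M.PosSemidef) (x : ι → ℝ) :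
    0 ≤ x ⬝ᵥ M *ᵥ x := by
  simpa using hM.dotProduct_mulVec_nonneg x

variable [DecidableEq ι]

theorem Matrix.PosDef.isUnit_det {M : Matrix ι ι ℝ} (hM : M.PosDef) : IsUnit M.det :=
  (isUnit_iff_isUnit_det _).1 hM.isUnit

/-- Congruence by a non-singular matrix preserves positive definiteness. -/
theorem Matrix.PosDef.transpose_mul_mul {M T : Matrix ι ι ℝ} (hM : M.PosDef)
    (hT : IsUnit T.det) : (Tᵀ * M * T).PosDef := by
  have := hM.conjTranspose_mul_mul_same (mulVec_injective_of_isUnit ((isUnit_iff_isUnit_det T).2 hT))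
  rwa [conjTranspose_eq_transpose_of_trivial] at this

/-- If `b I ≤ M` with `0 < b`, then `M⁻¹ ≤ b⁻¹ I`. -/
theorem Matrix.PosDef.inv_quad_le {M : Matrix ι ι ℝ} (hM : M.PosDef) {b : ℝ} (hb : 0 < b)
    (h : ∀ x : ι → ℝ, b * (x ⬝ᵥ x) ≤ x ⬝ᵥ M *ᵥ x) (x : ι → ℝ) :
    x ⬝ᵥ M⁻¹ *ᵥ x ≤ b⁻¹ * (x ⬝ᵥ x) := by
  obtain ⟨y, rfl⟩ : ∃ y, x = M *ᵥ y :=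
    ⟨M⁻¹ *ᵥ x, by rw [mulVec_mulVec, mul_nonsing_inv _ hM.isUnit_det, one_mulVec]⟩
  rw [mulVec_mulVec, nonsing_inv_mul _ hM.isUnit_det, one_mulVec, dotProduct_comm _ y]
  -- Expanding |My - by|² ≥ 0 and using b²|y|² ≤ b y'My gives b y'My ≤ |My|², without diagonalizing.
  have h1 : 0 ≤ (M *ᵥ y - b • y) ⬝ᵥ (M *ᵥ y - b • y) := by
    simpa using dotProduct_star_self_nonneg (M *ᵥ y - b • y)
  have h2 := mul_le_mul_of_nonneg_left (h y) hb.le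
  simp only [sub_dotProduct, dotProduct_sub, smul_dotProduct, dotProduct_smul, smul_eq_mul,
    dotProduct_comm _ y] at h1
  rw [← div_eq_inv_mul, le_div_iff₀ hb]
  nlinarith

/-- If `M ≤ a I` with `0 < a`, then `a⁻¹ I ≤ M⁻¹`. -/
theorem Matrix.PosDef.le_inv_quad {M : Matrix ι ι ℝ} (hM : M.PosDef) {a : ℝ} (ha : 0 < a)
    (h : ∀ x : ι → ℝ, x ⬝ᵥ M *ᵥ x ≤ a * (x ⬝ᵥ x)) (x : ι → ℝ) :
    a⁻¹ * (x ⬝ᵥ x) ≤ x ⬝ᵥ M⁻¹ *ᵥ x := by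
  obtain ⟨y, rfl⟩ : ∃ y, x = M *ᵥ y :=
    ⟨M⁻¹ *ᵥ x, by rw [mulVec_mulVec, mul_nonsing_inv _ hM.isUnit_det, one_mulVec]⟩
  rw [mulVec_mulVec, nonsing_inv_mul _ hM.isUnit_det, one_mulVec, dotProduct_comm _ y]
  -- The form of M at ay - My, with (My)'M(My) ≤ a|My|², gives a|My|² ≤ a² y'My.
  have h1 := hM.posSemidef.quad_nonneg (a • y - M *ᵥ y)
  have h2 := h (M *ᵥ y)
  have h3 := hM.isHermitian.dotProduct_mulVec_comm y (M *ᵥ y)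
  simp only [mulVec_sub, mulVec_smul, sub_dotProduct, dotProduct_sub, smul_dotProduct,
    dotProduct_smul, smul_eq_mul] at h1
  rw [← div_eq_inv_mul, div_le_iff₀ ha]
  have h4 : a * ((M *ᵥ y) ⬝ᵥ (M *ᵥ y)) ≤ a * (a * (y ⬝ᵥ M *ᵥ y)) := by nlinarith
  nlinarith [le_of_mul_le_mul_left h4 ha]

end QuadraticForms

/-! ### Simultaneous diagonalization, isometries of the distance, extreme eigenvalues. -/

section Spectrum

variable {n : ℕ}

/-- Simultaneous diagonalization of a symmetric and a positive definite matrix. -/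
theorem exists_congr_diagonal {X P : Matrix (Fin n) (Fin n) ℝ} (hX : X.IsHermitian)
    (hP : P.PosDef) : ∃ (V : Matrix (Fin n) (Fin n) ℝ) (l : Fin n → ℝ), IsUnit V.det ∧
      Monotone l ∧ Vᵀ * P * V = 1 ∧ Vᵀ * X * V = diagonal l := by
  open scoped MatrixOrder in
  obtain ⟨L, hL⟩ := CStarAlgebra.nonneg_iff_eq_star_mul_self.mp hP.posSemidef.nonneg
  rw [star_eq_conjTranspose, conjTranspose_eq_transpose_of_trivial] at hL
  have hLu : IsUnit L.det := by
    have := hP.isUnit_det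
    rw [hL, det_mul] at this
    exact isUnit_of_mul_isUnit_right this
  have hN : ((L⁻¹)ᵀ * X * L⁻¹).IsHermitian := by
    simpa using isHermitian_conjTranspose_mul_mul (L⁻¹) hX
  set U : Matrix (Fin n) (Fin n) ℝ := ↑hN.eigenvectorUnitary with hU
  have hUU : Uᵀ * U = 1 := by
    simpa [star_eq_conjTranspose] using Unitary.coe_star_mul_self hN.eigenvectorUnitary
  have hspec : Uᵀ * ((L⁻¹)ᵀ * X * L⁻¹) * U = diagonal hN.eigenvalues := by
    have h := hN.spectral_theorem
    rw [Unitary.conjStarAlgAut_apply, ← hU] at h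
    rw [star_eq_conjTranspose, conjTranspose_eq_transpose_of_trivial] at h
    have h2 := congrArg (fun M => Uᵀ * M * U) h
    have h3 : Uᵀ * (U * diagonal (RCLike.ofReal ∘ hN.eigenvalues) * Uᵀ) * U =
      (Uᵀ * U) * diagonal hN.eigenvalues * (Uᵀ * U) := by
      simp only [Matrix.mul_assoc]; rfl
    rw [h2, h3, hUU, Matrix.one_mul, Matrix.mul_one]
  -- Sorting the columns makes the eigenvalues monotone, as the later min-max comparison requires.
  set σ := Tuple.sort hN.eigenvalues
  have hW1 : (L⁻¹ * U)ᵀ * P * (L⁻¹ * U) = 1 := by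
    calc _ = Uᵀ * ((L * L⁻¹)ᵀ * (L * L⁻¹)) * U := by
          rw [hL]; simp only [transpose_mul, Matrix.mul_assoc]
      _ = 1 := by rw [mul_nonsing_inv _ hLu]; simpa using hUU
  have hW2 : (L⁻¹ * U)ᵀ * X * (L⁻¹ * U) = diagonal hN.eigenvalues := by
    rw [← hspec]; simp only [transpose_mul, Matrix.mul_assoc]
  have hsub : ∀ M : Matrix (Fin n) (Fin n) ℝ,
      ((L⁻¹ * U).submatrix id σ)ᵀ * M * (L⁻¹ * U).submatrix id σ =
        ((L⁻¹ * U)ᵀ * M * (L⁻¹ * U)).submatrix σ σ := by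
    intro M; rfl
  refine ⟨(L⁻¹ * U).submatrix id σ, hN.eigenvalues ∘ σ, ?_, Tuple.monotone_sort _, ?_, ?_⟩
  · have h : ((L⁻¹ * U).submatrix id σ)ᵀ * P * (L⁻¹ * U).submatrix id σ = 1 := by
      rw [hsub, hW1, submatrix_one_equiv]
    have := congrArg det h
    rw [det_mul, det_one] at this
    exact IsUnit.of_mul_eq_one_right _ this
  · rw [hsub, hW1, submatrix_one_equiv]
  · rw [hsub, hW2, submatrix_diagonal_equiv]

theorem roots_charpoly_conj_diagonal {T : Matrix (Fin n) (Fin n) ℝ} (hT : IsUnit T.det)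
    (l : Fin n → ℝ) :
    (T * diagonal l * T⁻¹).charpoly.roots = Finset.univ.val.map l := by
  have h : (T * diagonal l * T⁻¹).charpoly = (diagonal l).charpoly := by
    rw [Matrix.mul_assoc, charpoly_mul_comm, Matrix.mul_assoc, nonsing_inv_mul _ hT,
      Matrix.mul_one]
  rw [h, charpoly_diagonal, Polynomial.roots_prod]
  · simp
  · simp [Finset.prod_ne_zero_iff, Polynomial.X_sub_C_ne_zero]

theorem eq_of_congr_diagonal {M V D : Matrix (Fin n) (Fin n) ℝ} (hV : IsUnit V.det)
    (h : Vᵀ * M * V = D) : M = (V⁻¹)ᵀ * D * V⁻¹ := by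
  rw [← h]
  calc M = (V * V⁻¹)ᵀ * M * (V * V⁻¹) := by simp [mul_nonsing_inv _ hV]
    _ = _ := by simp only [transpose_mul, Matrix.mul_assoc]

/-- XP⁻¹ = (V')⁻¹ diag(l) V' is similar to diag(l). This replaces characteristic polynomial roots by
the relative eigenvalues l. -/
theorem riemDist_eq {X P V : Matrix (Fin n) (Fin n) ℝ} {l : Fin n → ℝ} (hV : IsUnit V.det)
    (hP : Vᵀ * P * V = 1) (hX : Vᵀ * X * V = diagonal l) :
    riemDist X P = Real.sqrt (∑ i, (Real.log (l i)) ^ 2) := by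
  have hVt : IsUnit (V⁻¹)ᵀ.det := by
    rw [det_transpose]; exact isUnit_nonsing_inv_det _ hV
  have hPi : P⁻¹ = V * Vᵀ := by
    refine inv_eq_left_inv ?_
    have h := eq_of_congr_diagonal hV hP
    rw [h, Matrix.mul_one]
    calc V * Vᵀ * ((V⁻¹)ᵀ * V⁻¹) = V * (V⁻¹ * V)ᵀ * V⁻¹ := by
          simp only [transpose_mul, Matrix.mul_assoc]
      _ = 1 := by simp [nonsing_inv_mul _ hV, mul_nonsing_inv _ hV]
  have h : X * P⁻¹ = (V⁻¹)ᵀ * diagonal l * ((V⁻¹)ᵀ)⁻¹ := by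
    rw [eq_of_congr_diagonal hV hX, hPi, transpose_nonsing_inv, nonsing_inv_nonsing_inv]
    · calc _ = (Vᵀ)⁻¹ * diagonal l * (V⁻¹ * V) * Vᵀ := by simp only [Matrix.mul_assoc]
        _ = _ := by rw [nonsing_inv_mul _ hV, Matrix.mul_one]
    · rwa [det_transpose]
  rw [riemDist, h, roots_charpoly_conj_diagonal hVt, Multiset.map_map]
  rfl

/-- T⁻¹V diagonalizes the transformed pair with the same l. -/
theorem riemDist_congr {X P T : Matrix (Fin n) (Fin n) ℝ} (hX : X.PosDef) (hP : P.PosDef)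
    (hT : IsUnit T.det) : riemDist (Tᵀ * X * T) (Tᵀ * P * T) = riemDist X P := by
  obtain ⟨V, l, hV, -, h1, h2⟩ := exists_congr_diagonal hX.isHermitian hP
  have key : ∀ M, (T⁻¹ * V)ᵀ * (Tᵀ * M * T) * (T⁻¹ * V) = Vᵀ * M * V := by
    intro M
    calc _ = Vᵀ * ((T * T⁻¹)ᵀ * M * (T * T⁻¹)) * V := by
          simp only [transpose_mul, Matrix.mul_assoc]
      _ = _ := by simp [mul_nonsing_inv _ hT]
  rw [riemDist_eq hV h1 h2, riemDist_eq (V := T⁻¹ * V) (l := l)]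
  · rw [det_mul]; exact (isUnit_nonsing_inv_det _ hT).mul hV
  · rw [key, h1]
  · rw [key, h2]

/-- (V⁻¹)' diagonalizes the inverse pair with entries 1/l, and squaring removes the sign of the
logarithm. -/
theorem riemDist_inv {X P : Matrix (Fin n) (Fin n) ℝ} (hX : X.PosDef) (hP : P.PosDef) :
    riemDist X⁻¹ P⁻¹ = riemDist X P := by
  obtain ⟨V, l, hV, -, h1, h2⟩ := exists_congr_diagonal hX.isHermitian hP
  have key : ∀ M, ((V⁻¹)ᵀ)ᵀ * M⁻¹ * (V⁻¹)ᵀ = (Vᵀ * M * V)⁻¹ := by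
    intro M
    simp only [Matrix.mul_inv_rev, transpose_nonsing_inv, transpose_transpose, Matrix.mul_assoc]
  have hl : ∀ i, l i ≠ 0 := by
    intro i
    have h := (hX.transpose_mul_mul hV).isUnit_det
    rw [h2, det_diagonal, isUnit_iff_ne_zero, Finset.prod_ne_zero_iff] at h
    exact h i (Finset.mem_univ i)
  rw [riemDist_eq hV h1 h2, riemDist_eq (V := (V⁻¹)ᵀ) (l := fun i => (l i)⁻¹)]
  · simp
  · rw [det_transpose]; exact isUnit_nonsing_inv_det _ hV
  · rw [key, h1, inv_one]
  · rw [key, h2]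
    refine inv_eq_left_inv ?_
    simp [diagonal_mul_diagonal, hl]

theorem quad_diagonal (l x : Fin n → ℝ) : x ⬝ᵥ diagonal l *ᵥ x = ∑ i, l i * x i ^ 2 := by
  simp only [dotProduct, mulVec_diagonal]
  exact Finset.sum_congr rfl fun i _ => by ring

theorem quad_of_congr_diagonal {M V : Matrix (Fin n) (Fin n) ℝ} {l : Fin n → ℝ}
    (hV : IsUnit V.det) (h : Vᵀ * M * V = diagonal l) (x : Fin n → ℝ) :
    x ⬝ᵥ M *ᵥ x = ∑ i, l i * (V⁻¹ *ᵥ x) i ^ 2 := by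
  rw [← quad_diagonal, ← dotProduct_transpose_mul_mul_mulVec, ← eq_of_congr_diagonal hV h]

theorem spectrum_eq_range {Y V : Matrix (Fin n) (Fin n) ℝ} {l : Fin n → ℝ}
    (hV : IsUnit V.det) (h1 : Vᵀ * 1 * V = 1) (h2 : Vᵀ * Y * V = diagonal l) :
    spectrum ℝ Y = Set.range l := by
  have hVi : V⁻¹ = Vᵀ := inv_eq_left_inv (by simpa using h1)
  have hY : Y = V * diagonal l * V⁻¹ := by
    rw [eq_of_congr_diagonal hV h2, hVi, transpose_transpose]
  ext r
  have h0 : Y.charpoly ≠ 0 := (charpoly_monic Y).ne_zero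
  rw [mem_spectrum_iff_isRoot_charpoly, ← Polynomial.mem_roots h0, hY,
    roots_charpoly_conj_diagonal hV]
  simp

theorem lamMin_mul_le {Y : Matrix (Fin n) (Fin n) ℝ} (hY : Y.IsHermitian) (x : Fin n → ℝ) :
    lamMin Y * (x ⬝ᵥ x) ≤ x ⬝ᵥ Y *ᵥ x := by
  obtain ⟨V, l, hV, -, h1, h2⟩ := exists_congr_diagonal hY PosDef.one
  have h3 : x ⬝ᵥ x = ∑ i, 1 * (V⁻¹ *ᵥ x) i ^ 2 := by
    have := quad_of_congr_diagonal (l := fun _ => 1) hV (by rw [h1, diagonal_one]) x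
    rwa [one_mulVec] at this
  rw [h3, quad_of_congr_diagonal hV h2, Finset.mul_sum]
  refine Finset.sum_le_sum fun i _ => ?_
  rw [one_mul]
  refine mul_le_mul_of_nonneg_right ?_ (sq_nonneg _)
  rw [lamMin, spectrum_eq_range hV h1 h2]
  exact csInf_le (Set.finite_range l).bddBelow ⟨i, rfl⟩

theorem le_lamMax_mul {Y : Matrix (Fin n) (Fin n) ℝ} (hY : Y.IsHermitian) (x : Fin n → ℝ) :
    x ⬝ᵥ Y *ᵥ x ≤ lamMax Y * (x ⬝ᵥ x) := by
  obtain ⟨V, l, hV, -, h1, h2⟩ := exists_congr_diagonal hY PosDef.one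
  have h3 : x ⬝ᵥ x = ∑ i, 1 * (V⁻¹ *ᵥ x) i ^ 2 := by
    have := quad_of_congr_diagonal (l := fun _ => 1) hV (by rw [h1, diagonal_one]) x
    rwa [one_mulVec] at this
  rw [h3, quad_of_congr_diagonal hV h2, Finset.mul_sum]
  refine Finset.sum_le_sum fun i _ => ?_
  rw [one_mul]
  refine mul_le_mul_of_nonneg_right ?_ (sq_nonneg _)
  rw [lamMax, spectrum_eq_range hV h1 h2]
  exact le_csSup (Set.finite_range l).bddAbove ⟨i, rfl⟩

theorem Matrix.PosDef.diagonal_pos_of_congr {Y V : Matrix (Fin n) (Fin n) ℝ} {l : Fin n → ℝ}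
    (hY : Y.PosDef) (hV : IsUnit V.det) (h : Vᵀ * Y * V = Matrix.diagonal l) (i : Fin n) :
    0 < l i := by
  have := hY.transpose_mul_mul hV
  rw [h, posDef_diagonal_iff] at this
  exact this i

/-- For n = 0 the spectrum is empty and `sInf ∅ = 0`, hence the need for `hn`; otherwise the infimum
is attained. The same applies to `lamMax_pos`. -/
theorem lamMin_pos (hn : 0 < n) {Y : Matrix (Fin n) (Fin n) ℝ} (hY : Y.PosDef) :
    0 < lamMin Y := by
  obtain ⟨V, l, hV, -, h1, h2⟩ := exists_congr_diagonal hY.isHermitian PosDef.one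
  have : Nonempty (Fin n) := ⟨⟨0, hn⟩⟩
  obtain ⟨i, hi⟩ := (Set.range_nonempty l).csInf_mem (Set.finite_range l)
  rw [lamMin, spectrum_eq_range hV h1 h2, ← hi]
  exact hY.diagonal_pos_of_congr hV h2 i

theorem lamMax_pos (hn : 0 < n) {Y : Matrix (Fin n) (Fin n) ℝ} (hY : Y.PosDef) :
    0 < lamMax Y := by
  obtain ⟨V, l, hV, -, h1, h2⟩ := exists_congr_diagonal hY.isHermitian PosDef.one
  have : Nonempty (Fin n) := ⟨⟨0, hn⟩⟩
  obtain ⟨i, hi⟩ := (Set.range_nonempty l).csSup_mem (Set.finite_range l)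
  rw [lamMax, spectrum_eq_range hV h1 h2, ← hi]
  exact hY.diagonal_pos_of_congr hV h2 i

end Spectrum

/-! ### Contraction under addition of a matrix. -/

section Contraction

/-- Translating numerator and denominator of a quotient shrinks its distance to `1`. -/
theorem add_le_rpow_mul_add {a b κ c L : ℝ} (ha : 0 < a) (hb : 0 < b) (hc : 0 ≤ c)
    (hκ : c * a ≤ κ) (hL : 1 ≤ L) (hab : a ≤ L * b) :
    a + κ ≤ L ^ (1 / (1 + c)) * (b + κ) := by
  have hκ0 : 0 ≤ κ := (mul_nonneg hc ha.le).trans hκ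
  have hρ : 0 ≤ 1 / (1 + c) := by positivity
  rcases le_or_gt a b with h | h
  · have : 1 ≤ L ^ (1 / (1 + c)) := Real.one_le_rpow hL hρ
    nlinarith
  · have hr : 0 < a / b := div_pos ha hb
    have h1 : (a / b) ^ (1 / (1 + c)) ≤ L ^ (1 / (1 + c)) :=
      Real.rpow_le_rpow hr.le ((div_le_iff₀ hb).2 hab) hρ
    refine le_trans ?_ (mul_le_mul_of_nonneg_right h1 (by positivity))
    -- Weighted AM-GM on 1 and a/b, multiplied by p below, is exactly the claim in the worst case κ
    -- = ca.
    have h2 := Real.geom_mean_le_arith_mean2_weighted (w₁ := 1 / (1 + c)) (w₂ := c / (1 + c))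
      (p₁ := 1) (p₂ := a / b) hρ (by positivity) zero_le_one hr.le (by field_simp)
    rw [Real.one_rpow, one_mul] at h2
    have h3 : (a / b) ^ (1 / (1 + c)) * (a / b) ^ (c / (1 + c)) = a / b := by
      rw [← Real.rpow_add hr, ← add_div, div_self (by positivity), Real.rpow_one]
    set p := (a / b) ^ (1 / (1 + c)) with hp
    have hp0 : 0 < p := Real.rpow_pos_of_pos hr _
    have h4 : a * (1 + c) ≤ p * (b + c * a) := by
      have h5 := mul_le_mul_of_nonneg_left h2 hp0.le
      rw [h3, div_le_iff₀ hb] at h5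
      have : a * (1 + c) ≤ (p * (1 / (1 + c) * 1 + c / (1 + c) * (a / b)) * b) * (1 + c) :=
        mul_le_mul_of_nonneg_right h5 (by positivity)
      refine this.trans (le_of_eq ?_)
      field_simp
    -- For a > b the quotient (a + κ)/(b + κ) decreases in κ, which reduces to κ = ca.
    have h5 : (a + κ) * (b + c * a) ≤ a * (1 + c) * (b + κ) := by
      nlinarith [mul_nonneg (sub_nonneg.2 h.le) (sub_nonneg.2 hκ)]
    have h6 : 0 < b + c * a := by positivity
    refine le_of_mul_le_mul_right ?_ h6
    calc _ ≤ a * (1 + c) * (b + κ) := h5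
      _ ≤ p * (b + c * a) * (b + κ) := mul_le_mul_of_nonneg_right h4 (by positivity)
      _ = _ := by ring

variable {n : ℕ}

/-- Only n - 1 linear conditions are imposed, one for each j ≠ i. This is the dimension count behind
Courant-Fischer. -/
theorem exists_ne_zero_mulVec_eq_zero (V W : Matrix (Fin n) (Fin n) ℝ) (i : Fin n) :
    ∃ x : Fin n → ℝ, x ≠ 0 ∧ (∀ j, i < j → (V *ᵥ x) j = 0) ∧ ∀ j, j < i → (W *ᵥ x) j = 0 := by
  let f : (Fin n → ℝ) →ₗ[ℝ] ({j : Fin n // j ≠ i} → ℝ) :=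
    LinearMap.pi fun j => if j.1 < i then (LinearMap.proj j.1) ∘ₗ W.mulVecLin
      else (LinearMap.proj j.1) ∘ₗ V.mulVecLin
  have hf : LinearMap.ker f ≠ ⊥ := by
    apply LinearMap.ker_ne_bot_of_finrank_lt
    have := i.pos
    simp
    omega
  obtain ⟨x, hx, hx0⟩ := Submodule.exists_mem_ne_zero_of_ne_bot hf
  rw [LinearMap.mem_ker] at hx
  refine ⟨x, hx0, fun j hj => ?_, fun j hj => ?_⟩
  · have := congrFun hx ⟨j, hj.ne'⟩
    simpa [f, hj.not_gt] using this
  · have := congrFun hx ⟨j, hj.ne⟩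
    simpa [f, hj] using this

theorem sum_mul_sq_le {l y : Fin n → ℝ} (hl : Monotone l) {i : Fin n}
    (hy : ∀ j, i < j → y j = 0) : ∑ j, l j * y j ^ 2 ≤ l i * ∑ j, y j ^ 2 := by
  rw [Finset.mul_sum]
  refine Finset.sum_le_sum fun j _ => ?_
  rcases lt_or_ge i j with h | h
  · simp [hy j h]
  · exact mul_le_mul_of_nonneg_right (hl h) (sq_nonneg _)

theorem le_sum_mul_sq {l y : Fin n → ℝ} (hl : Monotone l) {i : Fin n}
    (hy : ∀ j, j < i → y j = 0) : l i * ∑ j, y j ^ 2 ≤ ∑ j, l j * y j ^ 2 := by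
  rw [Finset.mul_sum]
  refine Finset.sum_le_sum fun j _ => ?_
  rcases lt_or_ge j i with h | h
  · simp [hy j h]
  · exact mul_le_mul_of_nonneg_right (hl h) (sq_nonneg _)

/-- Adding `K` with `c X ≤ K` and `c P ≤ K` contracts the Riemannian distance by `1 / (1 + c)`. -/
theorem riemDist_add_le {X P K : Matrix (Fin n) (Fin n) ℝ} (hX : X.PosDef) (hP : P.PosDef)
    (hK : K.PosSemidef) {c : ℝ} (hc : 0 ≤ c)
    (hXK : ∀ x : Fin n → ℝ, c * (x ⬝ᵥ X *ᵥ x) ≤ x ⬝ᵥ K *ᵥ x)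
    (hPK : ∀ x : Fin n → ℝ, c * (x ⬝ᵥ P *ᵥ x) ≤ x ⬝ᵥ K *ᵥ x) :
    riemDist (X + K) (P + K) ≤ 1 / (1 + c) * riemDist X P := by
  obtain ⟨V, l, hV, hl, hVP, hVX⟩ := exists_congr_diagonal hX.isHermitian hP
  have hXK' := hX.add_posSemidef hK
  have hPK' := hP.add_posSemidef hK
  obtain ⟨W, r, hW, hr, hWP, hWX⟩ := exists_congr_diagonal hXK'.isHermitian hPK'
  have hlpos := hX.diagonal_pos_of_congr hV hVX
  have hrpos := hXK'.diagonal_pos_of_congr hW hWX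
  have qX := quad_of_congr_diagonal hV hVX
  have qP : ∀ x : Fin n → ℝ, x ⬝ᵥ P *ᵥ x = ∑ i, (V⁻¹ *ᵥ x) i ^ 2 := fun x => by
    simpa using quad_of_congr_diagonal (l := fun _ => 1) hV (by rw [hVP, diagonal_one]) x
  have qXK : ∀ x : Fin n → ℝ,
      x ⬝ᵥ X *ᵥ x + x ⬝ᵥ K *ᵥ x = ∑ i, r i * (W⁻¹ *ᵥ x) i ^ 2 := fun x => by
    rw [← quad_of_congr_diagonal hW hWX, add_mulVec, dotProduct_add]
  have qPK : ∀ x : Fin n → ℝ,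
      x ⬝ᵥ P *ᵥ x + x ⬝ᵥ K *ᵥ x = ∑ i, (W⁻¹ *ᵥ x) i ^ 2 := fun x => by
    have := quad_of_congr_diagonal (l := fun _ => 1) hW (by rw [hWP, diagonal_one]) x
    rw [add_mulVec, dotProduct_add] at this
    simpa using this
  have hρ : 0 ≤ 1 / (1 + c) := by positivity
  rw [riemDist_eq hV hVP hVX, riemDist_eq hW hWP hWX]
  have key : ∀ i, |Real.log (r i)| ≤ 1 / (1 + c) * |Real.log (l i)| := by
    intro i
    -- The scalar bound needs L ≥ 1, so max 1 s is used; its logarithm is still at most |log s|.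
    have hmax : ∀ s : ℝ, 0 < s → Real.log (max 1 s) ≤ |Real.log s| := by
      intro s hs
      rcases le_total 1 s with h | h
      · rw [max_eq_right h]; exact le_abs_self _
      · rw [max_eq_left h, Real.log_one]; exact abs_nonneg _
    have hlog : ∀ s t : ℝ, 0 < s → 0 < t → t ≤ (max 1 s) ^ (1 / (1 + c)) →
        Real.log t ≤ 1 / (1 + c) * |Real.log s| := by
      intro s t hs ht h
      have h1 : 0 < max 1 s := lt_max_of_lt_left one_pos
      have := Real.log_le_log ht h
      rw [Real.log_rpow h1] at this
      exact this.trans (mul_le_mul_of_nonneg_left (hmax s hs) hρ)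
    refine abs_le'.2 ⟨?_, ?_⟩
    · refine hlog _ _ (hlpos i) (hrpos i) ?_
      -- At this x, the form of X is at most l i times that of P, while that of X + K is at least r
      -- i times that of P + K.
      obtain ⟨x, hx, h1, h2⟩ := exists_ne_zero_mulVec_eq_zero V⁻¹ W⁻¹ i
      have ha := hX.quad_pos hx
      have hb := hP.quad_pos hx
      have hk := hK.quad_nonneg x
      have h3 := sum_mul_sq_le hl h1
      have h4 := le_sum_mul_sq hr h2
      rw [← qX, ← qP] at h3
      rw [← qXK, ← qPK] at h4
      have h5 := add_le_rpow_mul_add ha hb hc (hXK x) (le_max_left 1 (l i))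
        (h3.trans (mul_le_mul_of_nonneg_right (le_max_right _ _) hb.le))
      exact le_of_mul_le_mul_right (h4.trans h5) (by positivity)
    · rw [← Real.log_inv, ← abs_neg (Real.log (l i)), ← Real.log_inv]
      refine hlog _ _ (inv_pos.2 (hlpos i)) (inv_pos.2 (hrpos i)) ?_
      -- The reversed inequalities, with X and P exchanged, bound 1 / r i by a power of max 1 (1 / l
      -- i).
      obtain ⟨x, hx, h1, h2⟩ := exists_ne_zero_mulVec_eq_zero W⁻¹ V⁻¹ i
      have ha := hX.quad_pos hx
      have hb := hP.quad_pos hx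
      have hk := hK.quad_nonneg x
      have h3 := le_sum_mul_sq hl h2
      have h4 := sum_mul_sq_le hr h1
      rw [← qX, ← qP] at h3
      rw [← qXK, ← qPK] at h4
      have h3' : x ⬝ᵥ P *ᵥ x ≤ (l i)⁻¹ * (x ⬝ᵥ X *ᵥ x) := by
        rwa [← div_eq_inv_mul, le_div_iff₀ (hlpos i), mul_comm]
      have h5 := add_le_rpow_mul_add hb ha hc (hPK x) (le_max_left 1 (l i)⁻¹)
        (h3'.trans (mul_le_mul_of_nonneg_right (le_max_right _ _) ha.le))
      have h6 : 0 ≤ (max 1 (l i)⁻¹) ^ (1 / (1 + c)) :=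
        Real.rpow_nonneg (zero_le_one.trans (le_max_left _ _)) _
      have h7 := h5.trans (mul_le_mul_of_nonneg_left h4 h6)
      rw [← mul_assoc] at h7
      have h8 : 1 ≤ (max 1 (l i)⁻¹) ^ (1 / (1 + c)) * r i :=
        le_of_mul_le_mul_right (by rwa [one_mul]) (by positivity : 0 < x ⬝ᵥ P *ᵥ x + x ⬝ᵥ K *ᵥ x)
      rwa [← one_div, div_le_iff₀ (hrpos i)]
  refine Real.sqrt_le_iff.2 ⟨mul_nonneg hρ (Real.sqrt_nonneg _), ?_⟩
  rw [mul_pow, Real.sq_sqrt (Finset.sum_nonneg fun i _ => sq_nonneg _), Finset.mul_sum]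
  refine Finset.sum_le_sum fun i _ => ?_
  rw [← mul_pow, sq_le_sq, abs_mul, abs_of_nonneg hρ]
  exact key i

end Contraction

/-! ### Inverse identities and contraction of the Möbius map. -/

section InverseIdentities

variable {n : ℕ}

/-- The left side equals P⁻¹S(P + S)⁻¹, and P + PS⁻¹P factors as (P + S)S⁻¹P. -/
theorem inv_sub_inv_add {P S : Matrix (Fin n) (Fin n) ℝ} (hP : IsUnit P.det) (hS : IsUnit S.det)
    (hPS : IsUnit (P + S).det) : P⁻¹ - (P + S)⁻¹ = (P + P * S⁻¹ * P)⁻¹ := by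
  symm
  refine inv_eq_left_inv ?_
  have h1 : P + P * S⁻¹ * P = (P + S) * S⁻¹ * P := by
    rw [Matrix.add_mul, Matrix.add_mul, mul_nonsing_inv _ hS, Matrix.one_mul, add_comm]
  have h2 : P⁻¹ - (P + S)⁻¹ = P⁻¹ * S * (P + S)⁻¹ := by
    calc P⁻¹ - (P + S)⁻¹ = P⁻¹ * ((P + S) * (P + S)⁻¹) - P⁻¹ * P * (P + S)⁻¹ := by
          rw [mul_nonsing_inv _ hPS, nonsing_inv_mul _ hP, Matrix.mul_one, Matrix.one_mul]
      _ = _ := by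
          rw [Matrix.add_mul, Matrix.mul_add, Matrix.mul_assoc, Matrix.mul_assoc,
            add_sub_cancel_left]
  rw [h1, h2]
  calc P⁻¹ * S * (P + S)⁻¹ * ((P + S) * S⁻¹ * P)
      = P⁻¹ * (S * ((P + S)⁻¹ * (P + S)) * S⁻¹) * P := by simp only [Matrix.mul_assoc]
    _ = 1 := by
      rw [nonsing_inv_mul _ hPS, Matrix.mul_one, mul_nonsing_inv _ hS, Matrix.mul_one,
        nonsing_inv_mul _ hP]

theorem Matrix.PosDef.isSymm {M : Matrix (Fin n) (Fin n) ℝ} (hM : M.PosDef) : Mᵀ = M := by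
  rw [← conjTranspose_eq_transpose_of_trivial, hM.isHermitian.eq]

theorem Matrix.PosDef.inv_mul_mul {M Q : Matrix (Fin n) (Fin n) ℝ} (hM : M.PosDef)
    (hQ : Q.PosDef) : (Q * M * Q).PosDef := by
  have := hM.transpose_mul_mul hQ.isUnit_det
  rwa [hQ.isSymm] at this

/-- Decomposition of the inverse of `Q + (Y⁻¹ + V)⁻¹` into a constant and the inverse of an affine
function of `Y`. -/
theorem inv_add_inv_inv_add {Q V Y : Matrix (Fin n) (Fin n) ℝ} (hQ : Q.PosDef) (hV : V.PosDef)
    (hY : Y.PosDef) :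
    (Q + (Y⁻¹ + V)⁻¹)⁻¹ = ((Q + Q * V * Q) + (Q⁻¹ * (Q + Q * V * Q))ᵀ * Y *
      (Q⁻¹ * (Q + Q * V * Q)))⁻¹ + (Q + V⁻¹)⁻¹ := by
  set H := Q + Q * V * Q with hHdef
  have hH : H.PosDef := hQ.add (hV.inv_mul_mul hQ)
  have hS := hY.inv.add hV
  -- The three differences telescope, because Q + Q(Y⁻¹ + V)Q = H + QY⁻¹Q: the terms Q⁻¹ and H⁻¹
  -- cancel.
  have h1 := inv_sub_inv_add hQ.isUnit_det hS.inv.isUnit_det (hQ.add hS.inv).isUnit_det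
  have h2 := inv_sub_inv_add hQ.isUnit_det hV.inv.isUnit_det (hQ.add hV.inv).isUnit_det
  have hYQ := hY.inv.inv_mul_mul hQ
  have h3 := inv_sub_inv_add hH.isUnit_det hYQ.isUnit_det (hH.add hYQ).isUnit_det
  rw [nonsing_inv_nonsing_inv _ hS.isUnit_det] at h1
  rw [nonsing_inv_nonsing_inv _ hV.isUnit_det, ← hHdef] at h2
  have e1 : Q + Q * (Y⁻¹ + V) * Q = H + Q * Y⁻¹ * Q := by
    rw [hHdef, Matrix.mul_add, Matrix.add_mul]; abel
  have e2 : H + H * (Q * Y⁻¹ * Q)⁻¹ * H = H + (Q⁻¹ * H)ᵀ * Y * (Q⁻¹ * H) := by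
    rw [transpose_mul, hH.isSymm, hQ.inv.isSymm, Matrix.mul_inv_rev, Matrix.mul_inv_rev,
      nonsing_inv_nonsing_inv _ hY.isUnit_det]
    simp only [Matrix.mul_assoc]
  rw [e1] at h1
  rw [e2] at h3
  rw [← h3, ← h1, ← h2]
  abel

/-- The Möbius map `Y ↦ Q + (Y⁻¹ + V)⁻¹` is a strict contraction of the Riemannian distance. -/
theorem riemDist_mobius_le (hn : 0 < n) {Q V Y Z : Matrix (Fin n) (Fin n) ℝ} (hQ : Q.PosDef)
    (hV : V.PosDef) (hY : Y.PosDef) (hZ : Z.PosDef) {ζ ε : ℝ}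
    (hζ : ζ = 1 / lamMin (Q + Q * V * Q)) (hε : ε = 1 / lamMax (Q + V⁻¹)) :
    riemDist (Q + (Y⁻¹ + V)⁻¹) (Q + (Z⁻¹ + V)⁻¹) ≤ ζ / (ζ + ε) * riemDist Y Z := by
  have hH : (Q + Q * V * Q).PosDef := hQ.add (hV.inv_mul_mul hQ)
  have hKi : (Q + V⁻¹).PosDef := hQ.add hV.inv
  have hmin := lamMin_pos hn hH
  have hmax := lamMax_pos hn hKi
  have hζ0 : 0 < ζ := hζ ▸ one_div_pos.2 hmin
  have hε0 : 0 < ε := hε ▸ one_div_pos.2 hmax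
  have hG : IsUnit (Q⁻¹ * (Q + Q * V * Q)).det := by
    rw [det_mul]; exact hQ.inv.isUnit_det.mul hH.isUnit_det
  rw [← riemDist_inv (hQ.add (hY.inv.add hV).inv) (hQ.add (hZ.inv.add hV).inv),
    inv_add_inv_inv_add hQ hV hY, inv_add_inv_inv_add hQ hV hZ, ← riemDist_congr hY hZ hG]
  set H := Q + Q * V * Q
  set G := Q⁻¹ * H
  have hYG := hY.transpose_mul_mul hG
  have hZG := hZ.transpose_mul_mul hG
  set K := (Q + V⁻¹)⁻¹
  have hK : K.PosDef := hKi.inv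
  have hKε : ∀ x : Fin n → ℝ, ε * (x ⬝ᵥ x) ≤ x ⬝ᵥ K *ᵥ x := fun x => by
    rw [hε, one_div]; exact hKi.le_inv_quad hmax (le_lamMax_mul hKi.isHermitian) x
  -- H + Y ≥ H ≥ ζ⁻¹I gives (H + Y)⁻¹ ≤ ζI, while K ≥ εI; hence the constant c = ε/ζ.
  have hbound : ∀ Y : Matrix (Fin n) (Fin n) ℝ, Y.PosDef → ∀ x : Fin n → ℝ,
      ε / ζ * (x ⬝ᵥ (H + Y)⁻¹ *ᵥ x) ≤ x ⬝ᵥ K *ᵥ x := by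
    intro Y hY x
    have h1 := (hH.add hY).inv_quad_le hmin (fun x => by
      rw [add_mulVec, dotProduct_add]
      exact (lamMin_mul_le hH.isHermitian x).trans
        (le_add_of_nonneg_right (hY.posSemidef.quad_nonneg x))) x
    rw [← one_div (lamMin H), ← hζ] at h1
    refine le_trans ?_ (hKε x)
    calc _ ≤ ε / ζ * (ζ * (x ⬝ᵥ x)) := mul_le_mul_of_nonneg_left h1 (by positivity)
      _ = _ := by field_simp
  have hc : 1 / (1 + ε / ζ) = ζ / (ζ + ε) := by field_simp
  rw [← hc]
  refine (riemDist_add_le (hH.add hYG).inv (hH.add hZG).inv hK.posSemidef (by positivity)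
    (hbound _ hYG) (hbound _ hZG)).trans ?_
  refine mul_le_mul_of_nonneg_left ?_ (by positivity)
  -- What remains is the addition of H, which is non-expansive: the case c = 0.
  rw [riemDist_inv (hH.add hYG) (hH.add hZG), add_comm H, add_comm H]
  have := riemDist_add_le hYG hZG hH.posSemidef le_rfl
    (fun x => by rw [zero_mul]; exact hH.posSemidef.quad_nonneg x)
    (fun x => by rw [zero_mul]; exact hH.posSemidef.quad_nonneg x)
  simpa using this

end InverseIdentities

/-! ### Determinant lemma and Woodbury identity. -/

section Woodbury

variable {n : ℕ} {ι : Type*} [Fintype ι] [DecidableEq ι]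

/-- R may be indefinite, so positivity of the sum is not available. Instead its determinant factors
as det R · det X · det(X⁻¹ + BR⁻¹B'). -/
theorem isUnit_det_add_transpose_mul_mul {R : Matrix ι ι ℝ} {B : Matrix (Fin n) ι ℝ}
    {X : Matrix (Fin n) (Fin n) ℝ} (hR : IsUnit R.det) (hX : X.PosDef)
    (hW : (B * R⁻¹ * Bᵀ).PosDef) : IsUnit (R + Bᵀ * X * B).det := by
  rw [Matrix.mul_assoc, det_add_mul _ _ hR]
  refine hR.mul ?_
  have h : 1 + X * B * R⁻¹ * Bᵀ = X * (X⁻¹ + B * R⁻¹ * Bᵀ) := by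
    rw [Matrix.mul_add, mul_nonsing_inv _ hX.isUnit_det]
    simp only [Matrix.mul_assoc]
  rw [h, det_mul]
  exact hX.isUnit_det.mul (hX.inv.add hW).isUnit_det

theorem sub_mul_inv_mul_eq_inv {R : Matrix ι ι ℝ} {B : Matrix (Fin n) ι ℝ}
    {X : Matrix (Fin n) (Fin n) ℝ} (hR : IsUnit R.det) (hX : X.PosDef)
    (hW : (B * R⁻¹ * Bᵀ).PosDef) :
    X - X * B * (R + Bᵀ * X * B)⁻¹ * Bᵀ * X = (X⁻¹ + B * R⁻¹ * Bᵀ)⁻¹ := by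
  have h := add_mul_mul_inv_eq_sub X⁻¹ B R⁻¹ Bᵀ hX.inv.isUnit
    ((isUnit_iff_isUnit_det _).2 (isUnit_nonsing_inv_det _ hR))
    (by
      rw [nonsing_inv_nonsing_inv _ hR, nonsing_inv_nonsing_inv _ hX.isUnit_det,
        isUnit_iff_isUnit_det]
      exact isUnit_det_add_transpose_mul_mul hR hX hW)
  rw [h, nonsing_inv_nonsing_inv _ hR, nonsing_inv_nonsing_inv _ hX.isUnit_det]

theorem transpose_mul_inv_mul {T M : Matrix (Fin n) (Fin n) ℝ} (hT : IsUnit T.det) :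
    Tᵀ * M⁻¹ * T = (T⁻¹ * M * Tᵀ⁻¹)⁻¹ := by
  rw [Matrix.mul_inv_rev, Matrix.mul_inv_rev, nonsing_inv_nonsing_inv _ hT,
    nonsing_inv_nonsing_inv _ (by rwa [det_transpose]), Matrix.mul_assoc]

end Woodbury

/-! ### The Riccati operator in Möbius form and the main theorem. -/

theorem ModelData.riccati_eq {n m : ℕ} (S : ModelData n m) (d t k : ℕ) {γ : ℝ}
    (hRt : IsUnit (S.tilR d t k γ).det) (hBRB : (S.tilBRB d t k γ).PosDef)
    (hT : IsUnit (S.tilA d t k γ).det) {X : Matrix (Fin n) (Fin n) ℝ} (hX : X.PosDef) :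
    S.riccati d t k γ X = S.tilQ d t k γ + (((S.tilA d t k γ)ᵀ * X * S.tilA d t k γ)⁻¹ +
      (S.tilA d t k γ)⁻¹ * S.tilBRB d t k γ * (S.tilA d t k γ)ᵀ⁻¹)⁻¹ := by
  have h1 := transpose_mul_inv_mul (M := X⁻¹) hT
  rw [nonsing_inv_nonsing_inv _ hX.isUnit_det] at h1
  rw [riccati, sub_mul_inv_mul_eq_inv hRt hX hBRB, h1, ← tilBRB,
    transpose_mul_inv_mul hT, Matrix.mul_add, Matrix.add_mul]
  congr 3
  rw [nonsing_inv_nonsing_inv]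
  rw [det_mul, det_mul, ← transpose_nonsing_inv, det_transpose]
  exact ((isUnit_nonsing_inv_det _ hT).mul hX.inv.isUnit_det).mul (isUnit_nonsing_inv_det _ hT)

/-- Strict contraction of the lifted Riccati operator in the Riemannian distance, with explicit
rate. The first four conclusions say that the inverses, eigenvalue quotients and distances in the
rate bound are the genuine ones. -/
theorem theorem3 {n m : ℕ} (hn : 0 < n) (S : ModelData n m)
    (hA : ∀ s : ℕ, IsUnit (S.A s).det)
    (hQ : ∀ s : ℕ, (S.Q s).PosSemidef)
    (hR : ∀ s : ℕ, (S.R s).PosDef)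
    (d : ℕ) (hd : 0 < d) (t k : ℕ) (γ : ℝ) (hγ : 0 < γ)
    (hRt : IsUnit (S.tilR d t k γ).det)
    (hBRB : (S.tilBRB d t k γ).PosDef)
    (hQt : (S.tilQ d t k γ).PosDef) :
    IsUnit (S.tilA d t k γ).det ∧
    (∀ X : Matrix (Fin n) (Fin n) ℝ, X.PosDef →
      IsUnit (S.tilR d t k γ + (S.tilB d t k).transpose * X * S.tilB d t k).det ∧
      (S.riccati d t k γ X).PosDef) ∧
    0 < S.zeta d t k γ ∧
    0 < S.epsilon d t k γ ∧
    S.rho d t k γ < 1 ∧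
    ∀ X P : Matrix (Fin n) (Fin n) ℝ, X.PosDef → P.PosDef →
      riemDist (S.riccati d t k γ X) (S.riccati d t k γ P) ≤ S.rho d t k γ * riemDist X P := by
  have hT := S.isUnit_det_tilA d t k hA hR hγ.ne' hRt
  set T := S.tilA d t k γ with hTdef
  set W := S.tilBRB d t k γ with hWdef
  set Q := S.tilQ d t k γ with hQdef
  have hV : (T⁻¹ * W * Tᵀ⁻¹).PosDef := by
    have := hBRB.transpose_mul_mul (T := Tᵀ⁻¹)
      (isUnit_nonsing_inv_det _ (by rwa [det_transpose]))
    rwa [transpose_nonsing_inv, transpose_transpose] at this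
  -- This identifies the matrix in `epsilon` with Q + V⁻¹, the form `riemDist_mobius_le` expects.
  have hVi : Tᵀ * W⁻¹ * T = (T⁻¹ * W * Tᵀ⁻¹)⁻¹ := transpose_mul_inv_mul hT
  have hζ : S.zeta d t k γ = 1 / lamMin (Q + Q * (T⁻¹ * W * Tᵀ⁻¹) * Q) := by
    rw [ModelData.zeta, ← hTdef, ← hWdef, ← hQdef]
    simp only [Matrix.mul_assoc]
  have hε : S.epsilon d t k γ = 1 / lamMax (Q + (T⁻¹ * W * Tᵀ⁻¹)⁻¹) := by
    rw [ModelData.epsilon, ← hTdef, ← hWdef, ← hQdef, hVi]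
  have hζ0 : 0 < S.zeta d t k γ :=
    hζ ▸ one_div_pos.2 (lamMin_pos hn (hQt.add (hV.inv_mul_mul hQt)))
  have hε0 : 0 < S.epsilon d t k γ := hε ▸ one_div_pos.2 (lamMax_pos hn (hQt.add hV.inv))
  refine ⟨hT, fun X hX => ⟨isUnit_det_add_transpose_mul_mul hRt hX hBRB, ?_⟩, hζ0, hε0, ?_, ?_⟩
  · rw [S.riccati_eq d t k hRt hBRB hT hX]
    exact hQt.add ((hX.transpose_mul_mul hT).inv.add hV).inv
  · rw [ModelData.rho, div_lt_one (by positivity)]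
    linarith
  · intro X P hX hP
    rw [S.riccati_eq d t k hRt hBRB hT hX, S.riccati_eq d t k hRt hBRB hT hP,
      ← riemDist_congr hX hP hT]
    exact riemDist_mobius_le hn hQt hV (hX.transpose_mul_mul hT) (hP.transpose_mul_mul hT) hζ hε
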